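/- Let $f\colon\{0,1,2\}^*\to\{0,1,2\}^*$ be the morphism defined by $0\mapsto 012$, $1\mapsto 112002$, $2\mapsto\varepsilon$ (the empty word). There is exactly one infinite word $\mathbf{x}=012112002112002\cdots$ over $\{0,1,2\}$ that starts with $0$ and is a fixed point of $f$, i.e. $f(\mathbf{x})=\mathbf{x}$. Two finite words $u,v$ over $\{0,1,2\}$ are called additively equivalent if they have the same length and the same sum of letters, i.e. $|u|=|v|$ and $|u|_1+2|u|_2=|v|_1+2|v|_2$, where $|w|_a$ is the number of occurrences of the letter $a$ in $w$. They are called abelian equivalent if they are permutations of each other. For $n\ge 0$ let $\rho^{\mathrm{add}}_{\mathbf{x}}(n)$ (resp. $\rho^{\mathrm{ab}}_{\mathbf{x}}(n)$) be the number of length-$n$ factors (contiguous blocks) of $\mathbf{x}$, counted up to additive (resp. abelian) equivalence. Then the sequence $(\rho^{\mathrm{add}}_{\mathbf{x}}(n))_{n\ge 0}$ is $134(355)^\omega$, and the sequence $(\rho^{\mathrm{ab}}_{\mathbf{x}}(n))_{n\ge 0}$ is $135(377)^\omega$, where $p\,q^\omega$ denotes the eventually periodic sequence $pqqq\cdots$.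 -/

import Mathlib

/-- The image of a finite word `w` under the morphism of free monoids that is determined by the
images `f a` of the letters `a`. -/
def morphismImage {α β : Type*} (f : α → List β) (w : List α) : List β :=
  w.flatMap f

/-- The factor `x(i) x(i+1) ⋯ x(i+n-1)` of length `n` of the infinite word `x`. -/
def wordFactor {α : Type*} (x : ℕ → α) (i n : ℕ) : List α :=
  List.ofFn fun j : Fin n => x (i + j)

/-- The infinite word `x` is a fixed point of the morphism given by `f`: the infinite
concatenation `f(x(0)) f(x(1)) f(x(2)) ⋯` is an infinite word and equals `x`. As letters may be
erased, this means that the images of the prefixes of `x` are prefixes of `x` and that their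
lengths are unbounded. -/
def IsFixedPointOfMorphism {α : Type*} (f : α → List α) (x : ℕ → α) : Prop :=
  (∀ n : ℕ, morphismImage f (wordFactor x 0 n) =
      wordFactor x 0 (morphismImage f (wordFactor x 0 n)).length) ∧
    ∀ N : ℕ, ∃ n : ℕ, N ≤ (morphismImage f (wordFactor x 0 n)).length

/-- The set of factors of length `n` of the infinite word `x`. -/
def factorSet {α : Type*} (x : ℕ → α) (n : ℕ) : Set (List α) :=
  Set.range fun i : ℕ => wordFactor x i n

/-- Additive equivalence of words over the alphabet `{0, 1, …, l}`: same length and same sum of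
letters, where the sum is `∑ a, a * |u|_a`. -/
def AdditivelyEquivalent {l : ℕ} (u v : List (Fin (l + 1))) : Prop :=
  u.length = v.length ∧
    ∑ a : Fin (l + 1), (a : ℕ) * u.count a = ∑ a : Fin (l + 1), (a : ℕ) * v.count a

/-- Additive equivalence as an equivalence relation. -/
def additiveSetoid (l : ℕ) : Setoid (List (Fin (l + 1))) where
  r := AdditivelyEquivalent
  iseqv :=
    { refl := fun _ => ⟨rfl, rfl⟩
      symm := fun h => ⟨h.1.symm, h.2.symm⟩
      trans := fun h k => ⟨h.1.trans k.1, h.2.trans k.2⟩ }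

/-- The number of factors of length `n` of `x`, counted up to the equivalence relation `r`. -/
noncomputable def complexityUpTo {α : Type*} (r : Setoid (List α)) (x : ℕ → α) (n : ℕ) : ℕ :=
  Nat.card (Quotient (r.comap (Subtype.val : factorSet x n → List α)))

/-- The additive complexity function of an infinite word over `{0, 1, …, l}`. -/
noncomputable def additiveComplexity {l : ℕ} (x : ℕ → Fin (l + 1)) : ℕ → ℕ :=
  complexityUpTo (additiveSetoid l) x

/-- The abelian complexity function of an infinite word: factors are counted up to permutation of
their letters. -/
noncomputable def abelianComplexity {α : Type*} (x : ℕ → α) : ℕ → ℕ :=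
  complexityUpTo (List.isSetoid α) x

/-- The infinite word `p q q q ⋯` (for non-empty `q`), indexed from `0`. -/
def eventuallyPeriodicWord (p q : List ℕ) (n : ℕ) : ℕ :=
  if n < p.length then p.getD n 0 else q.getD ((n - p.length) % q.length) 0

/-- The letter images of the morphism `0 ↦ 012, 1 ↦ 112002, 2 ↦ ε`. -/
def exampleMorphism : Fin 3 → List (Fin 3) :=
  ![[0, 1, 2], [1, 1, 2, 0, 0, 2], []]

/-!
All images of letters under `0 ↦ 012, 1 ↦ 112002, 2 ↦ ε` are concatenations of the three blocks
`a = 012`, `b = 112`, `c = 002`, so the fixed point is a sequence of such blocks. On blocks the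
morphism acts as `a ↦ abc, b ↦ bcbc, c ↦ aa`. Since `c` follows exactly the blocks `b`
(`blockSeq_succ_eq_c_iff`), the last `c` of `bcbc` may be moved to the image of the next block, and
the block sequence is also fixed by the uniform morphism `a ↦ abc, b ↦ bcb, c ↦ caa`. This is how
`blockSeq` is defined; the concatenation `blockWord` of its blocks is a fixed point of the original
morphism (`isFixedPointOfMorphism_blockWord`). It is the only one that starts with `0`, because
images of nonempty prefixes are longer than these prefixes
(`IsFixedPointOfMorphism.eq_of_lt_length`).

Factors of equal length are abelian equivalent if they have the same numbers of ones and of twos,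
and additively equivalent if `(number of ones) + 2 * (number of twos)` agrees. Every third letter is
`2`, and the first `k` blocks hold `k` ones, and one more if the next block is `c` (`excessAt`). So
the counts in a factor are determined by its length and place modulo three and by the few values of
`excessAt` at its two ends, which leaves at most three or seven pairs of counts for each length.
That all of them occur follows from the fact that, at every distance at least two, there are blocks
`c` before `a`, `a` before `a`, and `a` before `c` (`occursAtDistance_extremal`). As the block
sequence is fixed by a 3-uniform morphism, this is an induction on the distance in base three.
-/

/-! ### Blocks and the candidate word -/

/-- The three blocks of length three into which the fixed point splits: `012`, `112`, `002`. -/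
inductive Block
  | a
  | b
  | c

namespace Block

/-- The block as a word over `{0, 1, 2}`. -/
def word : Block → List (Fin 3)
  | a => [0, 1, 2]
  | b => [1, 1, 2]
  | c => [0, 0, 2]

/-- The `j`-th letter of the image of a block under the 3-uniform morphism
`a ↦ abc, b ↦ bcb, c ↦ caa`. -/
def child : Block → ℕ → Block
  | a, 0 => a
  | a, 1 => b
  | a, _ => c
  | b, 0 => b
  | b, 1 => c
  | b, _ => b
  | c, 0 => c
  | c, _ => a

/-- The number of ones in the blocks before an occurrence of the block in the fixed point, minus the
number of these blocks. It depends only on the block: before `c` it is `1`, otherwise `0`. -/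
def excess : Block → ℕ
  | a => 0
  | b => 0
  | c => 1

end Block

open Block in
/-- The fixed point `abcbcbcaa⋯` of the 3-uniform morphism `a ↦ abc, b ↦ bcb, c ↦ caa`. -/
def blockSeq (n : ℕ) : Block :=
  if n = 0 then a else child (blockSeq (n / 3)) (n % 3)
termination_by n
decreasing_by omega

/-- The infinite word that is the concatenation of the blocks of `blockSeq`. -/
def blockWord (n : ℕ) : Fin 3 :=
  (blockSeq (n / 3)).word.getD (n % 3) 0

open Block

/-! ### The block sequence -/

lemma blockSeq_three_mul_add (k j : ℕ) (hj : j < 3) :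
    blockSeq (3 * k + j) = child (blockSeq k) j := by
  rcases Nat.eq_zero_or_pos (3 * k + j) with h | h
  · obtain ⟨rfl, rfl⟩ : k = 0 ∧ j = 0 := by omega
    simp [blockSeq, child]
  · rw [blockSeq, if_neg h.ne', show (3 * k + j) / 3 = k by omega,
      show (3 * k + j) % 3 = j by omega]

lemma blockSeq_zero : blockSeq 0 = a := by simp [blockSeq]

lemma blockSeq_three_mul (k : ℕ) : blockSeq (3 * k) = blockSeq k := by
  rw [← add_zero (3 * k), blockSeq_three_mul_add k 0 (by norm_num)]
  cases blockSeq k <;> rfl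

/-- The block `c` occurs exactly after the blocks `b`. -/
lemma blockSeq_succ_eq_c_iff (k : ℕ) : blockSeq (k + 1) = c ↔ blockSeq k = b := by
  induction k using Nat.strong_induction_on with
  | _ k ih =>
    obtain ⟨q, j, hj, rfl⟩ : ∃ q j, j < 3 ∧ k = 3 * q + j := ⟨k / 3, k % 3, by omega, by omega⟩
    have h (j : ℕ) (hj : j < 3) := blockSeq_three_mul_add q j hj
    interval_cases j
    · rw [add_assoc, h 1 (by norm_num), h 0 (by norm_num)]
      cases blockSeq q <;> simp [child]
    · rw [add_assoc, h 2 (by norm_num), h 1 (by norm_num)]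
      cases blockSeq q <;> simp [child]
    · rw [show 3 * q + 2 + 1 = 3 * (q + 1) by ring, blockSeq_three_mul, ih q (by omega),
        h 2 (by norm_num)]
      cases blockSeq q <;> simp [child]

/-- `OccursAtDistance s t m`: somewhere in `blockSeq`, the block `t` stands `m` places after the
block `s`. -/
def OccursAtDistance (s t : Block) (m : ℕ) : Prop :=
  ∃ k, blockSeq k = s ∧ blockSeq (k + m) = t

/-- A pair of blocks at distance `q` passes on to the pairs of their images, at all distances that
arise from a place `i` in the first image and a place `j` in the second. -/
lemma OccursAtDistance.child {s t : Block} {q m : ℕ} (h : OccursAtDistance s t q) (i j : ℕ)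
    (hi : i < 3) (hj : j < 3) (hm : i + m = 3 * q + j) :
    OccursAtDistance (s.child i) (t.child j) m := by
  obtain ⟨k, rfl, rfl⟩ := h
  exact ⟨3 * k + i, blockSeq_three_mul_add k i hi, by
    rw [show 3 * k + i + m = 3 * (k + q) + j by omega, blockSeq_three_mul_add _ j hj]⟩

lemma occursAtDistance_one : OccursAtDistance c a 1 ∧ OccursAtDistance a a 1 := by
  have h0 : OccursAtDistance a a 0 := ⟨0, blockSeq_zero, blockSeq_zero⟩
  -- `a ↦ abc ↦ abcbcbcaa`
  have hcc : OccursAtDistance c c 0 := h0.child 2 2 (by norm_num) (by norm_num) (by norm_num)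
  exact ⟨hcc.child 0 1 (by norm_num) (by norm_num) (by norm_num),
    hcc.child 1 2 (by norm_num) (by norm_num) (by norm_num)⟩

/-- The pairs of blocks that are extremal for the number of ones occur at all distances. The three
claims are proved together by induction on the ternary expansion of the distance. -/
lemma occursAtDistance_extremal (m : ℕ) (hm : 1 ≤ m) :
    OccursAtDistance c a m ∧ OccursAtDistance a a m ∧ (2 ≤ m → OccursAtDistance a c m) := by
  induction m using Nat.strong_induction_on with
  | _ m ih =>
    have h0 : OccursAtDistance a a 0 := ⟨0, blockSeq_zero, blockSeq_zero⟩
    have hcc : OccursAtDistance c c 0 := h0.child 2 2 (by norm_num) (by norm_num) (by norm_num)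
    obtain ⟨hca1, haa1⟩ := occursAtDistance_one
    obtain ⟨q, j, hj, rfl⟩ : ∃ q j, j < 3 ∧ m = 3 * q + j := ⟨m / 3, m % 3, by omega, by omega⟩
    interval_cases j
    · obtain ⟨hca, haa, hac⟩ := ih q (by omega) (by omega)
      refine ⟨hca.child 0 0 (by omega) (by omega) (by omega),
        haa.child 0 0 (by omega) (by omega) (by omega), fun _ => ?_⟩
      rcases Nat.lt_or_ge q 2 with hq | hq
      · obtain rfl : q = 1 := by omega
        -- `ab ↦ abcbcb` contains `cb ↦ caabcb`, whose second and fifth letters are `a` and `c`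
        have hcb : OccursAtDistance a b 1 := ⟨0, blockSeq_zero, by
          rw [show 1 = 3 * 0 + 1 from rfl, blockSeq_three_mul_add 0 1 (by norm_num), blockSeq_zero]
          rfl⟩
        have : OccursAtDistance c b 1 := hcb.child 2 0 (by omega) (by omega) (by omega)
        exact this.child 1 1 (by omega) (by omega) (by omega)
      · exact (hac hq).child 0 0 (by omega) (by omega) (by omega)
    · rcases Nat.eq_zero_or_pos q with rfl | hq
      · exact ⟨hca1, haa1, by omega⟩
      obtain ⟨hca, haa, -⟩ := ih (q + 1) (by omega) (by omega)
      obtain ⟨hca', -, -⟩ := ih q (by omega) (by omega)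
      exact ⟨haa.child 2 0 (by omega) (by omega) (by omega),
        hca.child 2 0 (by omega) (by omega) (by omega),
        fun _ => hca'.child 1 2 (by omega) (by omega) (by omega)⟩
    · obtain ⟨hca, -, hac⟩ := ih (q + 1) (by omega) (by omega)
      have haa : OccursAtDistance a a q := by
        rcases Nat.eq_zero_or_pos q with rfl | hq
        · exact h0
        · exact (ih q (by omega) hq).2.1
      refine ⟨?_, hca.child 1 0 (by omega) (by omega) (by omega),
        fun _ => haa.child 0 2 (by omega) (by omega) (by omega)⟩
      rcases Nat.eq_zero_or_pos q with rfl | hq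
      · exact hcc.child 0 2 (by omega) (by omega) (by omega)
      · exact (hac (by omega)).child 2 1 (by omega) (by omega) (by omega)

/-! ### Factors of infinite words -/

section Factors

variable {α : Type*} (x : ℕ → α)

lemma wordFactor_length (i n : ℕ) : (wordFactor x i n).length = n := by
  simp [wordFactor]

lemma wordFactor_add (i m n : ℕ) :
    wordFactor x i (m + n) = wordFactor x i m ++ wordFactor x (i + m) n := by
  simp [wordFactor, List.ofFn_add, add_assoc]

lemma wordFactor_one (i : ℕ) : wordFactor x i 1 = [x i] := by
  simp [wordFactor]

lemma count_wordFactor [DecidableEq α] (s : α) (i n : ℕ) :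
    (wordFactor x 0 i).count s + (wordFactor x i n).count s = (wordFactor x 0 (i + n)).count s := by
  rw [wordFactor_add, List.count_append, zero_add]

end Factors

lemma morphismImage_append {α β : Type*} (f : α → List β) (u v : List α) :
    morphismImage f (u ++ v) = morphismImage f u ++ morphismImage f v := by
  simp [morphismImage]

/-- A fixed point is determined by its first letter if the images of its nonempty prefixes are
longer than these prefixes: each letter lies in the image of the prefix before it. -/
lemma IsFixedPointOfMorphism.eq_of_lt_length {α : Type*} {f : α → List α} {x y : ℕ → α}
    (hx : IsFixedPointOfMorphism f x) (hy : IsFixedPointOfMorphism f y) (h0 : x 0 = y 0)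
    (hlen : ∀ n, 1 ≤ n → n < (morphismImage f (wordFactor y 0 n)).length) : x = y := by
  funext n
  induction n using Nat.strong_induction_on with
  | _ n ih =>
    rcases Nat.eq_zero_or_pos n with rfl | hn
    · exact h0
    have hpre : wordFactor x 0 n = wordFactor y 0 n := by
      simp only [wordFactor, zero_add]
      congr 1
      funext j
      exact ih j j.2
    have hn' := hlen n hn
    have hx' := hx.1 n
    rw [hpre, hy.1 n, wordFactor_length] at hx'
    have h := congrArg (fun l => l[n]?) hx'
    have hget (w : ℕ → α) {L : ℕ} (hL : n < L) : (wordFactor w 0 L)[n]? = some (w n) := by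
      simp [wordFactor, hL]
    rw [hget y hn', hget x hn', Option.some.injEq] at h
    exact h.symm

/-! ### The fixed point of the morphism -/

lemma wordFactor_blockWord (k : ℕ) : wordFactor blockWord (3 * k) 3 = (blockSeq k).word := by
  have h (j : ℕ) (hj : j < 3) : blockWord (3 * k + j) = (blockSeq k).word.getD j 0 := by
    rw [blockWord, show (3 * k + j) / 3 = k by omega, show (3 * k + j) % 3 = j by omega]
  simp only [wordFactor, List.ofFn_succ, List.ofFn_zero]
  simp only [Fin.val_zero, Fin.val_succ]
  rw [h 0 (by omega), h (0 + 1) (by omega), h (0 + 1 + 1) (by omega)]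
  cases blockSeq k <;> rfl

lemma wordFactor_blockWord_succ (k : ℕ) :
    wordFactor blockWord 0 (3 * k + 3) = wordFactor blockWord 0 (3 * k) ++ (blockSeq k).word := by
  rw [wordFactor_add, zero_add, wordFactor_blockWord]

lemma wordFactor_blockWord_prefix (k j : ℕ) (hj : j ≤ 3) :
    wordFactor blockWord (3 * k) j = (blockSeq k).word.take j := by
  obtain ⟨i, hi⟩ := Nat.exists_eq_add_of_le hj
  have h := wordFactor_add blockWord (3 * k) j i
  rw [← hi, wordFactor_blockWord] at h
  rw [h, List.take_left' (wordFactor_length _ _ _)]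

lemma excess_succ (k : ℕ) :
    (blockSeq (k + 1)).excess = match blockSeq k with | b => 1 | _ => 0 := by
  have h := blockSeq_succ_eq_c_iff k
  cases h1 : blockSeq k <;> cases h2 : blockSeq (k + 1) <;> simp_all [excess]

/-- The image of the first `j` letters of the `k`-th block stands in the fixed point at the place
where the image of the first `k` blocks ends. The case `j = 3` says where the next image starts. -/
lemma morphismImage_block (k j : ℕ) (hj : j ≤ 3) :
    ∃ n, morphismImage exampleMorphism ((blockSeq k).word.take j) =
      wordFactor blockWord (9 * k + 3 * (blockSeq k).excess) n ∧
      (j = 3 → 9 * k + 3 * (blockSeq k).excess + n =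
        9 * (k + 1) + 3 * (blockSeq (k + 1)).excess) ∧
      (1 ≤ j → 3 ≤ n) ∧ (2 ≤ j → 6 ≤ n) := by
  have h0 := wordFactor_blockWord (3 * k)
  have h1 := wordFactor_blockWord (3 * k + 1)
  have h2 := wordFactor_blockWord (3 * k + 2)
  have h3 := wordFactor_blockWord (3 * (k + 1))
  rw [blockSeq_three_mul] at h0 h3
  rw [blockSeq_three_mul_add k _ (by norm_num)] at h1 h2
  rw [show 3 * (3 * k) = 9 * k by ring] at h0
  rw [show 3 * (3 * k + 1) = 9 * k + 3 by ring] at h1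
  rw [show 3 * (3 * k + 2) = 9 * k + 3 + 3 by ring] at h2
  rw [show 3 * (3 * (k + 1)) = 9 * k + 3 + 3 + 3 by ring] at h3
  have hnil (i : ℕ) : wordFactor blockWord i 0 = [] := rfl
  have h6 (i : ℕ) : wordFactor blockWord i 6 = _ := wordFactor_add blockWord i 3 3
  have h9 (i : ℕ) : wordFactor blockWord i 9 = _ := wordFactor_add blockWord i 3 6
  have h12 (i : ℕ) : wordFactor blockWord i 12 = _ := wordFactor_add blockWord i 6 6
  rw [excess_succ]
  have hc := (blockSeq_succ_eq_c_iff k).2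
  -- the image of a block is read off from the blocks `3k + 1, 3k + 2` if it is `c`, from
  -- `3k, …, 3k + 2` if it is `a`, and from `3k, …, 3k + 3` if it is `b`, where
  -- the block `3k + 3` is `c` because the block `k + 1` is `c`
  refine ⟨(morphismImage exampleMorphism ((blockSeq k).word.take j)).length, ?_⟩
  cases hk : blockSeq k <;> rw [hk] at h0 h1 h2 hc <;> interval_cases j <;>
    simp_all [word, child, excess, morphismImage, exampleMorphism] <;> omega

lemma morphismImage_blocks (k : ℕ) :
    morphismImage exampleMorphism (wordFactor blockWord 0 (3 * k)) =
      wordFactor blockWord 0 (9 * k + 3 * (blockSeq k).excess) := by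
  induction k with
  | zero => simp [wordFactor, morphismImage, blockSeq_zero, excess]
  | succ k ih =>
    obtain ⟨n, hn, hn3, -⟩ := morphismImage_block k 3 le_rfl
    rw [mul_add, mul_one, wordFactor_blockWord_succ, morphismImage_append, ih, ← hn3 rfl,
      wordFactor_add _ 0 _ n, zero_add, ← hn]
    congr 2
    cases blockSeq k <;> rfl

lemma morphismImage_wordFactor_blockWord (n : ℕ) :
    ∃ m, morphismImage exampleMorphism (wordFactor blockWord 0 n) = wordFactor blockWord 0 m ∧
      n ≤ m ∧ (1 ≤ n → n < m) := by
  obtain ⟨k, j, hj, rfl⟩ : ∃ k j, j < 3 ∧ n = 3 * k + j := ⟨n / 3, n % 3, by omega, by omega⟩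
  obtain ⟨m, hm, -, h1, h2⟩ := morphismImage_block k j hj.le
  refine ⟨9 * k + 3 * (blockSeq k).excess + m, ?_, ?_, ?_⟩
  · rw [wordFactor_add, wordFactor_add, morphismImage_append, zero_add, zero_add,
      morphismImage_blocks, wordFactor_blockWord_prefix k j hj.le, hm]
  · interval_cases j <;> omega
  · interval_cases j <;> omega

lemma isFixedPointOfMorphism_blockWord : IsFixedPointOfMorphism exampleMorphism blockWord := by
  refine ⟨fun n => ?_, fun n => ⟨n, ?_⟩⟩
  · obtain ⟨m, hm, -⟩ := morphismImage_wordFactor_blockWord n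
    rw [hm, wordFactor_length]
  · obtain ⟨m, hm, h, -⟩ := morphismImage_wordFactor_blockWord n
    rwa [hm, wordFactor_length]

lemma blockWord_zero : blockWord 0 = 0 := by
  simp [blockWord, blockSeq_zero, word]

lemma IsFixedPointOfMorphism.eq_blockWord {x : ℕ → Fin 3}
    (hx : IsFixedPointOfMorphism exampleMorphism x) (h0 : x 0 = 0) : x = blockWord := by
  refine hx.eq_of_lt_length isFixedPointOfMorphism_blockWord (h0.trans blockWord_zero.symm) ?_
  intro n hn
  obtain ⟨m, hm, -, h⟩ := morphismImage_wordFactor_blockWord n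
  rw [hm, wordFactor_length]
  exact h hn

/-! ### Complexity as the number of values of an invariant -/

/-- Classes of factors correspond to the values of an invariant `F` that separates the classes. -/
lemma complexityUpTo_eq_ncard {α β : Type*} (r : Setoid (List α)) (x : ℕ → α) (n : ℕ)
    (F : List α → β)
    (hF : ∀ u v : List α, u.length = n → v.length = n → (r u v ↔ F u = F v)) :
    complexityUpTo r x n = (Set.range fun i => F (wordFactor x i n)).ncard := by
  have hlen (u : factorSet x n) : u.1.length = n := by
    obtain ⟨u, i, rfl⟩ := u
    exact wordFactor_length x i n
  have hr : r.comap (Subtype.val : factorSet x n → List α) =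
      Setoid.ker fun u : factorSet x n => F u.1 := by
    ext u v
    exact hF u.1 v.1 (hlen u) (hlen v)
  have hrange : (Set.range fun u : factorSet x n => F u.1) =
      Set.range fun i => F (wordFactor x i n) := by
    rw [Set.range_comp' F, Subtype.range_val, factorSet, ← Set.range_comp]
    rfl
  rw [complexityUpTo, hr, Nat.card_congr (Setoid.quotientKerEquivRange _), hrange,
    Nat.card_coe_set_eq]

lemma length_eq_count_add (u : List (Fin 3)) :
    u.length = u.count 0 + u.count 1 + u.count 2 := by
  induction u with
  | nil => rfl
  | cons s u ih =>
    fin_cases s <;> simp [ih] <;> omega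

/-- The numbers of ones and of twos in a word. -/
def onesTwos (u : List (Fin 3)) : ℕ × ℕ := (u.count 1, u.count 2)

lemma abelianComplexity_eq_ncard (x : ℕ → Fin 3) (n : ℕ) :
    abelianComplexity x n = (Set.range fun i => onesTwos (wordFactor x i n)).ncard := by
  refine complexityUpTo_eq_ncard _ x n onesTwos fun u v hu hv => ?_
  change u.Perm v ↔ _
  rw [List.perm_iff_count, Fin.forall_fin_succ, Fin.forall_fin_two]
  rw [length_eq_count_add] at hu hv
  simp only [onesTwos, Prod.mk.injEq]
  change u.count 0 = v.count 0 ∧ u.count 1 = v.count 1 ∧ u.count 2 = v.count 2 ↔ _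
  omega

lemma additiveComplexity_eq_ncard (x : ℕ → Fin 3) (n : ℕ) :
    additiveComplexity (l := 2) x n =
      ((fun p : ℕ × ℕ => p.1 + 2 * p.2) ''
        Set.range fun i => onesTwos (wordFactor x i n)).ncard := by
  rw [← Set.range_comp]
  refine complexityUpTo_eq_ncard _ x n (fun u => (onesTwos u).1 + 2 * (onesTwos u).2)
    fun u v hu hv => ?_
  change AdditivelyEquivalent u v ↔ _
  simp [AdditivelyEquivalent, onesTwos, Fin.sum_univ_three, hu, hv]

/-! ### Letter counts in the factors of the fixed point -/

lemma onesTwos_wordFactor_add (x : ℕ → Fin 3) (i n : ℕ) :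
    onesTwos (wordFactor x 0 i) + onesTwos (wordFactor x i n) =
      onesTwos (wordFactor x 0 (i + n)) := by
  simp [onesTwos, count_wordFactor]

/-- `excessAt k` is the excess of the number of ones over `k` in the first `k` blocks of the fixed
point; it is `1` if the next block is `c`, and `0` otherwise. -/
def excessAt (k : ℕ) : ℕ := (blockSeq k).excess

lemma excessAt_add_excessAt_succ_le (k : ℕ) : excessAt k + excessAt (k + 1) ≤ 1 := by
  rw [excessAt, excessAt, excess_succ]
  cases blockSeq k <;> simp [excess]

lemma excessAt_eq_one_of_c {k : ℕ} (h : blockSeq k = c) : excessAt k = 1 := by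
  simp [excessAt, h, excess]

lemma excessAt_eq_zero_of_a {k : ℕ} (h : blockSeq k = a) :
    excessAt k = 0 ∧ excessAt (k + 1) = 0 := by
  rw [excessAt, excessAt, excess_succ, h]
  exact ⟨rfl, rfl⟩

lemma onesTwos_prefix_three_mul (k : ℕ) :
    onesTwos (wordFactor blockWord 0 (3 * k)) = (k + excessAt k, k) := by
  induction k with
  | zero => simp [onesTwos, wordFactor, excessAt, blockSeq_zero, excess]
  | succ k ih =>
    rw [mul_add, mul_one, ← onesTwos_wordFactor_add, ih, wordFactor_blockWord, excessAt, excessAt,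
      excess_succ]
    cases blockSeq k <;> simp [onesTwos, word, excess, add_assoc]

lemma onesTwos_prefix_three_mul_add_one (k : ℕ) :
    onesTwos (wordFactor blockWord 0 (3 * k + 1)) = (k + excessAt k + excessAt (k + 1), k) := by
  rw [← onesTwos_wordFactor_add, onesTwos_prefix_three_mul,
    wordFactor_blockWord_prefix k 1 (by norm_num), excessAt, excessAt, excess_succ]
  cases blockSeq k <;> simp [onesTwos, word, excess]

lemma onesTwos_prefix_three_mul_add_two (k : ℕ) :
    onesTwos (wordFactor blockWord 0 (3 * k + 2)) = (k + 1 + excessAt (k + 1), k) := by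
  rw [← onesTwos_wordFactor_add, onesTwos_prefix_three_mul, excessAt, excessAt, excess_succ,
    wordFactor_blockWord_prefix k 2 (by norm_num)]
  cases blockSeq k <;> simp [onesTwos, word, excess]

/-- The pairs `onesTwos u` of the factors `u` of length `n` of the fixed point. -/
def factorCounts (n : ℕ) : Set (ℕ × ℕ) :=
  Set.range fun i => onesTwos (wordFactor blockWord i n)

/-- A factor is a difference of two prefixes, sorted by the residue of its place modulo three. -/
lemma mem_factorCounts_iff (n P Q : ℕ) :
    (P, Q) ∈ factorCounts n ↔ ∃ k,
      (k + excessAt k, k) + (P, Q) = onesTwos (wordFactor blockWord 0 (3 * k + n)) ∨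
      (k + excessAt k + excessAt (k + 1), k) + (P, Q) =
        onesTwos (wordFactor blockWord 0 (3 * k + 1 + n)) ∨
      (k + 1 + excessAt (k + 1), k) + (P, Q) =
        onesTwos (wordFactor blockWord 0 (3 * k + 2 + n)) := by
  have key (i : ℕ) : onesTwos (wordFactor blockWord i n) = (P, Q) ↔
      onesTwos (wordFactor blockWord 0 i) + (P, Q) =
        onesTwos (wordFactor blockWord 0 (i + n)) := by
    rw [← onesTwos_wordFactor_add, add_left_cancel_iff, eq_comm]
  simp only [← onesTwos_prefix_three_mul, ← onesTwos_prefix_three_mul_add_one,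
    ← onesTwos_prefix_three_mul_add_two, ← key]
  constructor
  · rintro ⟨i, hi⟩
    refine ⟨i / 3, ?_⟩
    obtain h | h | h : i = 3 * (i / 3) ∨ i = 3 * (i / 3) + 1 ∨ i = 3 * (i / 3) + 2 := by omega
    · exact Or.inl (h ▸ hi)
    · exact Or.inr (Or.inl (h ▸ hi))
    · exact Or.inr (Or.inr (h ▸ hi))
  · rintro ⟨k, h | h | h⟩ <;> exact ⟨_, h⟩

lemma mem_factorCounts_three_mul_iff (m P Q : ℕ) :
    (P, Q) ∈ factorCounts (3 * m) ↔ ∃ k, Q = m ∧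
      (excessAt k + P = m + excessAt (k + m) ∨
      excessAt k + excessAt (k + 1) + P = m + excessAt (k + m) + excessAt (k + m + 1) ∨
      excessAt (k + 1) + P = m + excessAt (k + m + 1)) := by
  rw [mem_factorCounts_iff]
  refine exists_congr fun k => ?_
  rw [show 3 * k + 3 * m = 3 * (k + m) by ring, show 3 * k + 1 + 3 * m = 3 * (k + m) + 1 by ring,
    show 3 * k + 2 + 3 * m = 3 * (k + m) + 2 by ring, onesTwos_prefix_three_mul,
    onesTwos_prefix_three_mul_add_one, onesTwos_prefix_three_mul_add_two]
  simp only [Prod.mk_add_mk, Prod.mk.injEq]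
  omega

lemma mem_factorCounts_three_mul_add_one_iff (m P Q : ℕ) :
    (P, Q) ∈ factorCounts (3 * m + 1) ↔ ∃ k,
      (Q = m ∧ (excessAt k + P = m + excessAt (k + m) + excessAt (k + m + 1) ∨
        excessAt k + excessAt (k + 1) + P = m + 1 + excessAt (k + m + 1))) ∨
      (Q = m + 1 ∧ excessAt (k + 1) + P = m + excessAt (k + m + 1)) := by
  rw [mem_factorCounts_iff]
  refine exists_congr fun k => ?_
  rw [show 3 * k + (3 * m + 1) = 3 * (k + m) + 1 by ring,
    show 3 * k + 1 + (3 * m + 1) = 3 * (k + m) + 2 by ring,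
    show 3 * k + 2 + (3 * m + 1) = 3 * (k + m + 1) by ring, onesTwos_prefix_three_mul,
    onesTwos_prefix_three_mul_add_one, onesTwos_prefix_three_mul_add_two]
  simp only [Prod.mk_add_mk, Prod.mk.injEq]
  omega

lemma mem_factorCounts_three_mul_add_two_iff (m P Q : ℕ) :
    (P, Q) ∈ factorCounts (3 * m + 2) ↔ ∃ k,
      (Q = m ∧ excessAt k + P = m + 1 + excessAt (k + m + 1)) ∨
      (Q = m + 1 ∧ (excessAt k + excessAt (k + 1) + P = m + 1 + excessAt (k + m + 1) ∨
        excessAt (k + 1) + P = m + excessAt (k + m + 1) + excessAt (k + m + 1 + 1))) := by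
  rw [mem_factorCounts_iff]
  refine exists_congr fun k => ?_
  rw [show 3 * k + (3 * m + 2) = 3 * (k + m) + 2 by ring,
    show 3 * k + 1 + (3 * m + 2) = 3 * (k + m + 1) by ring,
    show 3 * k + 2 + (3 * m + 2) = 3 * (k + m + 1) + 1 by ring, onesTwos_prefix_three_mul,
    onesTwos_prefix_three_mul_add_one, onesTwos_prefix_three_mul_add_two]
  simp only [Prod.mk_add_mk, Prod.mk.injEq]
  omega

/-! ### The letter counts that occur -/

/-- The index of the block `c` is written as a successor: `blockSeq` starts with `a`. -/
lemma exists_excessAt_c_a {m : ℕ} (hm : 1 ≤ m) :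
    ∃ k, excessAt (k + 1) = 1 ∧ excessAt (k + m + 1) = 0 ∧ excessAt (k + m + 1 + 1) = 0 := by
  obtain ⟨k, hc, ha⟩ := (occursAtDistance_extremal m hm).1
  cases k with
  | zero => simp [blockSeq_zero] at hc
  | succ k =>
    rw [show k + 1 + m = k + m + 1 by ring] at ha
    exact ⟨k, excessAt_eq_one_of_c hc, excessAt_eq_zero_of_a ha⟩

lemma exists_excessAt_a_a {m : ℕ} (hm : 1 ≤ m) :
    ∃ k, excessAt k = 0 ∧ excessAt (k + 1) = 0 ∧ excessAt (k + m) = 0 ∧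
      excessAt (k + m + 1) = 0 := by
  obtain ⟨k, ha, ha'⟩ := (occursAtDistance_extremal m hm).2.1
  exact ⟨k, (excessAt_eq_zero_of_a ha).1, (excessAt_eq_zero_of_a ha).2, excessAt_eq_zero_of_a ha'⟩

lemma exists_excessAt_a_c {m : ℕ} (hm : 1 ≤ m) :
    ∃ k, excessAt k = 0 ∧ excessAt (k + 1) = 0 ∧ excessAt (k + m + 1) = 1 := by
  obtain ⟨k, ha, hc⟩ := (occursAtDistance_extremal (m + 1) (by omega)).2.2 (by omega)
  exact ⟨k, (excessAt_eq_zero_of_a ha).1, (excessAt_eq_zero_of_a ha).2, excessAt_eq_one_of_c hc⟩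

lemma mem_factorCounts_three_mul {m : ℕ} (hm : 1 ≤ m) (P Q : ℕ) :
    (P, Q) ∈ factorCounts (3 * m) ↔ Q = m ∧ m ≤ P + 1 ∧ P ≤ m + 1 := by
  rw [mem_factorCounts_three_mul_iff]
  constructor
  · rintro ⟨k, h⟩
    have h1 := excessAt_add_excessAt_succ_le k
    have h2 := excessAt_add_excessAt_succ_le (k + m)
    omega
  · rintro ⟨rfl, h1, h2⟩
    obtain h | h | h : P + 1 = Q ∨ P = Q ∨ P = Q + 1 := by omega
    · obtain ⟨k, hk⟩ := exists_excessAt_c_a hm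
      exact ⟨k, by omega⟩
    · obtain ⟨k, hk⟩ := exists_excessAt_a_a hm
      exact ⟨k, by omega⟩
    · obtain ⟨k, hk⟩ := exists_excessAt_a_c hm
      exact ⟨k, by omega⟩

lemma mem_factorCounts_three_mul_add_one {m : ℕ} (hm : 1 ≤ m) (P Q : ℕ) :
    (P, Q) ∈ factorCounts (3 * m + 1) ↔
      (Q = m ∧ m ≤ P + 1 ∧ P ≤ m + 2) ∨ (Q = m + 1 ∧ m ≤ P + 1 ∧ P ≤ m + 1) := by
  rw [mem_factorCounts_three_mul_add_one_iff]
  constructor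
  · rintro ⟨k, h⟩
    have h1 := excessAt_add_excessAt_succ_le k
    have h2 := excessAt_add_excessAt_succ_le (k + m)
    omega
  · intro h
    obtain h' | h' | h' : P + 1 = m ∨ P = m ∨ m + 1 ≤ P := by omega
    · obtain ⟨k, hk⟩ := exists_excessAt_c_a hm
      rcases h with ⟨rfl, -⟩ | ⟨rfl, -⟩
      · refine ⟨k + 1, ?_⟩
        rw [show k + 1 + Q = k + Q + 1 by ring]
        omega
      · exact ⟨k, by omega⟩
    · obtain ⟨k, hk⟩ := exists_excessAt_a_a hm
      exact ⟨k, by omega⟩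
    · obtain ⟨k, hk⟩ := exists_excessAt_a_c hm
      have h2 := excessAt_add_excessAt_succ_le (k + m)
      exact ⟨k, by omega⟩

lemma mem_factorCounts_three_mul_add_two {m : ℕ} (hm : 1 ≤ m) (P Q : ℕ) :
    (P, Q) ∈ factorCounts (3 * m + 2) ↔
      (Q = m ∧ m ≤ P ∧ P ≤ m + 2) ∨ (Q = m + 1 ∧ m ≤ P + 1 ∧ P ≤ m + 2) := by
  rw [mem_factorCounts_three_mul_add_two_iff]
  constructor
  · rintro ⟨k, h⟩
    have h1 := excessAt_add_excessAt_succ_le k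
    have h2 := excessAt_add_excessAt_succ_le (k + m + 1)
    omega
  · intro h
    obtain h' | h' | h' | h' : P + 1 = m ∨ P = m ∨ P = m + 1 ∨ P = m + 2 := by omega
    · obtain ⟨k, hk⟩ := exists_excessAt_c_a hm
      exact ⟨k, by omega⟩
    · obtain ⟨k, hk⟩ := exists_excessAt_c_a (m := m + 1) (by omega)
      have h1 := excessAt_add_excessAt_succ_le (k + 1)
      refine ⟨k + 1, ?_⟩
      rw [show k + 1 + m + 1 = k + (m + 1) + 1 by ring]
      omega
    · obtain ⟨k, hk⟩ := exists_excessAt_a_a (m := m + 1) (by omega)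
      rw [← add_assoc] at hk
      exact ⟨k, by omega⟩
    · obtain ⟨k, hk⟩ := exists_excessAt_a_c hm
      exact ⟨k, by omega⟩

lemma excessAt_initial : excessAt 0 = 0 ∧ excessAt 1 = 0 ∧ excessAt 2 = 1 ∧ excessAt 3 = 0 := by
  have h1 := blockSeq_three_mul_add 0 1 (by norm_num)
  have h2 := blockSeq_three_mul_add 0 2 (by norm_num)
  have h3 := blockSeq_three_mul 1
  simp only [mul_zero, zero_add, mul_one, blockSeq_zero] at h1 h2 h3
  simp [excessAt, h1, h2, h3, blockSeq_zero, child, excess]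

lemma mem_factorCounts_one (P Q : ℕ) :
    (P, Q) ∈ factorCounts 1 ↔ (P, Q) = (0, 0) ∨ (P, Q) = (1, 0) ∨ (P, Q) = (0, 1) := by
  rw [show 1 = 3 * 0 + 1 from rfl, mem_factorCounts_three_mul_add_one_iff]
  simp only [add_zero, Prod.mk.injEq]
  constructor
  · rintro ⟨k, h⟩
    have h1 := excessAt_add_excessAt_succ_le k
    omega
  · obtain ⟨h0, h1, -⟩ := excessAt_initial
    intro h
    exact ⟨0, by simp only [zero_add]; omega⟩

lemma mem_factorCounts_two (P Q : ℕ) :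
    (P, Q) ∈ factorCounts 2 ↔
      (P, Q) = (0, 0) ∨ (P, Q) = (1, 0) ∨ (P, Q) = (2, 0) ∨ (P, Q) = (0, 1) ∨ (P, Q) = (1, 1) := by
  rw [show 2 = 3 * 0 + 2 from rfl, mem_factorCounts_three_mul_add_two_iff]
  simp only [add_zero, Prod.mk.injEq]
  constructor
  · rintro ⟨k, h⟩
    have h1 := excessAt_add_excessAt_succ_le k
    have h2 := excessAt_add_excessAt_succ_le (k + 1)
    omega
  · obtain ⟨h0, h1, h2, h3⟩ := excessAt_initial
    intro h
    obtain hP | hP | hP : P = 0 ∨ P = 1 ∨ P = 2 := by omega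
    · exact ⟨2, by norm_num [h2, h3]; omega⟩
    · exact ⟨0, by norm_num [h0, h1]; omega⟩
    · exact ⟨1, by norm_num [h1, h2]; omega⟩

/-! ### The complexity functions -/

/-- Cardinalities for a set of pairs that is the translate of a finite set `S` by `(d, d)`. The map
`(P, Q) ↦ P + 2 * Q` turns the number of ones and twos into the sum of the letters. -/
lemma ncard_of_translate {V : Set (ℕ × ℕ)} (d : ℕ) (S : Finset (ℕ × ℕ))
    (h : ∀ P Q, (P, Q) ∈ V ↔ d ≤ P ∧ d ≤ Q ∧ (P - d, Q - d) ∈ S) {s t : ℕ}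
    (hs : (S.image fun p => p.1 + 2 * p.2).card = s) (ht : S.card = t) :
    ((fun p : ℕ × ℕ => p.1 + 2 * p.2) '' V).ncard = s ∧ V.ncard = t := by
  subst hs ht
  have hV : V = (fun p : ℕ × ℕ => p + (d, d)) '' (S : Set (ℕ × ℕ)) := by
    ext ⟨P, Q⟩
    rw [h]
    constructor
    · rintro ⟨h1, h2, h3⟩
      exact ⟨_, h3, by simp [h1, h2]⟩
    · rintro ⟨⟨p, q⟩, hp, hpq⟩
      obtain ⟨rfl, rfl⟩ : p + d = P ∧ q + d = Q := by simpa using hpq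
      simpa using hp
  constructor
  · have hadd : (fun p : ℕ × ℕ => p.1 + 2 * p.2) '' V =
        (fun n => n + 3 * d) '' ((S.image fun p => p.1 + 2 * p.2 : Finset ℕ) : Set ℕ) := by
      rw [hV, Finset.coe_image, Set.image_image, Set.image_image]
      congr 1
      funext p
      simp only [Prod.fst_add, Prod.snd_add]
      ring
    rw [hadd, Set.ncard_image_of_injective _ (add_left_injective _), Set.ncard_coe_finset]
  · rw [hV, Set.ncard_image_of_injective _ (add_left_injective _), Set.ncard_coe_finset]

lemma complexity_blockWord (n : ℕ) :
    additiveComplexity (l := 2) blockWord n = eventuallyPeriodicWord [1, 3, 4] [3, 5, 5] n ∧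
      abelianComplexity blockWord n = eventuallyPeriodicWord [1, 3, 5] [3, 7, 7] n := by
  rw [additiveComplexity_eq_ncard, abelianComplexity_eq_ncard]
  change (_ '' factorCounts n).ncard = _ ∧ (factorCounts n).ncard = _
  rcases Nat.lt_or_ge n 3 with hn | hn
  · interval_cases n
    · refine ncard_of_translate 0 {(0, 0)} (fun P Q => ?_) (by decide) (by decide)
      simp [factorCounts, wordFactor, onesTwos]
    · refine ncard_of_translate 0 {(0, 0), (1, 0), (0, 1)} (fun P Q => ?_) (by decide) (by decide)
      rw [mem_factorCounts_one]
      simp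
    · refine ncard_of_translate 0 {(0, 0), (1, 0), (2, 0), (0, 1), (1, 1)} (fun P Q => ?_)
        (by decide) (by decide)
      rw [mem_factorCounts_two]
      simp
  · obtain ⟨m, r, hr, rfl⟩ : ∃ m r, r < 3 ∧ n = 3 * (m + 1) + r :=
      ⟨n / 3 - 1, n % 3, by omega, by omega⟩
    have hper (p q : List ℕ) (hp : p.length = 3) (hq : q.length = 3) :
        eventuallyPeriodicWord p q (3 * (m + 1) + r) = q.getD r 0 := by
      rw [eventuallyPeriodicWord, hp, hq, if_neg (by omega),
        show (3 * (m + 1) + r - 3) % 3 = r by omega]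
    rw [hper _ _ rfl rfl, hper _ _ rfl rfl]
    interval_cases r
    · refine ncard_of_translate m {(0, 1), (1, 1), (2, 1)} (fun P Q => ?_)
        (by decide) (by decide)
      rw [add_zero, mem_factorCounts_three_mul (by omega)]
      simp only [Finset.mem_insert, Finset.mem_singleton, Prod.mk.injEq]
      omega
    · refine ncard_of_translate m
        {(0, 1), (1, 1), (2, 1), (3, 1), (0, 2), (1, 2), (2, 2)} (fun P Q => ?_)
        (by decide) (by decide)
      rw [mem_factorCounts_three_mul_add_one (by omega)]
      simp only [Finset.mem_insert, Finset.mem_singleton, Prod.mk.injEq]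
      omega
    · refine ncard_of_translate m
        {(1, 1), (2, 1), (3, 1), (0, 2), (1, 2), (2, 2), (3, 2)} (fun P Q => ?_)
        (by decide) (by decide)
      rw [mem_factorCounts_three_mul_add_two (by omega)]
      simp only [Finset.mem_insert, Finset.mem_singleton, Prod.mk.injEq]
      omega

theorem mainTheorem8 :
    (∃! x : ℕ → Fin 3, IsFixedPointOfMorphism exampleMorphism x ∧ x 0 = 0) ∧
    ∀ x : ℕ → Fin 3, IsFixedPointOfMorphism exampleMorphism x → x 0 = 0 →
      additiveComplexity x = eventuallyPeriodicWord [1, 3, 4] [3, 5, 5] ∧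
      abelianComplexity x = eventuallyPeriodicWord [1, 3, 5] [3, 7, 7] := by
  refine ⟨⟨blockWord, ⟨isFixedPointOfMorphism_blockWord, blockWord_zero⟩,
    fun x hx => hx.1.eq_blockWord hx.2⟩, fun x hx h0 => ?_⟩
  rw [hx.eq_blockWord h0]
  exact ⟨funext fun n => (complexity_blockWord n).1, funext fun n => (complexity_blockWord n).2⟩
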